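/- A ring is a pair of concentric circles with outer radius $R>0$ and signed inner radius $r$, $|r|<R$ (the ring is oriented counter-clockwise if $r>0$, clockwise if $r<0$; if $r=0$ the inner circle is a point). An orthogonal ring pattern on $\mathbb Z^2$ assigns to each $(m,n)\in\mathbb Z^2$ a ring with inner circle $c_{m,n}$ and outer circle $C_{m,n}$ such that (1) for neighbouring vertices the inner circle of each ring intersects the outer circle of the other orthogonally; (2) in each square, $c_{m,n}$, $c_{m+1,n+1}$, $C_{m+1,n}$, $C_{m,n+1}$ pass through one point, where $C_{m+1,n}$ and $C_{m,n+1}$ touch externally and $c_{m,n}$ and $c_{m+1,n+1}$ touch, with centres on opposite sides of the common tangent if their radii have the same sign and on the same side if the signs differ; (3) the touching points around a vertex are ordered compatibly with the signs of the radii, that is, with outer circles taken counter-clockwise and inner circles oriented by the sign of their radius, the oriented unit tangents of $c_{m,n}, C_{m+1,n}, c_{m+1,n+1}, C_{m,n+1}$ at the common point are $t, it, -t, -it$ for some $t$. It has $\rho$-radii $\rho_{m,n}$ and ring area $\pi\ell^2$ if $R_{m,n}=\ell\cosh\rho_{m,n}$ and $r_{m,n}=\ell\sinh\rho_{m,n}$.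 An orthogonal circle pattern on $\mathbb Z^2$ with logarithmic radii $\rho_{m,n}$ consists of circles of radii $e^{\rho_{m,n}}$ such that neighbouring circles are orthogonal, and the four circles of each square pass through one point, where diagonally opposite ones touch externally, in positive orientation. Schramm's $\sqrt i$-Erf circle pattern is the one with radii $e^{amn}$. Let $a>0$. (i) For all $\ell>0$ and $\delta\in\mathbb R$ there is an orthogonal ring pattern on $\mathbb Z^2$ with ring area $\pi\ell^2$ and $\rho$-radii $\rho_{m,n}=amn+\delta$, unique up to orientation preserving isometries of the plane. In particular ($\delta=0$) the $\rho$-radii $\rho_{m,n}=amn$ define an orthogonal ring pattern, the Erf ring pattern. (ii) Let $\varphi_{i,j}$ denote the oriented angle at $i$ of the cyclic quadrilateral that is formed by the centres of the rings at two neighbouring vertices $i$, $j$ and the touching points in the two squares adjacent to the edge $(i,j)$. In the Erf ring pattern $$\varphi_{(m,n),(m+1,n)}=\pi-2\arctan(e^{-an}),\quad \varphi_{(m,n),(m,n+1)}=\pi-2\arctan(e^{-am})\qquad\text{if } mn>0,$$ $$\varphi_{(m,n),(m+1,n)}=-2\arctan(e^{-an}),\quad \varphi_{(m,n),(m,n+1)}=-2\arctan(e^{-am})\qquad\text{if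 } mn<0.$$ So within each open quadrant the first angle is constant along every horizontal line and the second one along every vertical line. (iii) The orthogonal circle patterns with radii $e^{amn}$ and $e^{-amn}$ exist and are unique up to orientation preserving isometries. Let $\mathcal R^\delta$ be an orthogonal ring pattern with $\rho$-radii $amn+\delta$ and $\ell=2e^{-|\delta|}$. Up to orientation preserving isometries (depending on $\delta$), the centres, touching points and inner and outer radii of $\mathcal R^\delta$ converge, for each vertex and each square, as $\delta\to+\infty$ to those of the $\sqrt i$-Erf circle pattern with radii $e^{amn}$; and as $\delta\to-\infty$ to those of the mirror image of the dual circle pattern with radii $e^{-amn}$, all circles being oriented clockwise (inner radii tending to $-e^{-amn}$, outer radii to $e^{-amn}$). This second limit is the $\sqrt i$-Erf circle pattern itself, up to an orientation preserving isometry, with its indices reflected by $(m,n)\mapsto(-m,n)$. -/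

import Mathlib

open Filter Topology

/-- Two circles (centres `z`, `w`, radii `a, b ≥ 0`) intersect orthogonally: they meet, and in every
common point the two radius vectors are perpendicular. A circle of radius `0` is its centre. -/
def OrthogonalCircles (z : ℂ) (a : ℝ) (w : ℂ) (b : ℝ) : Prop :=
  (Metric.sphere z a ∩ Metric.sphere w b).Nonempty ∧
    ∀ x ∈ Metric.sphere z a ∩ Metric.sphere w b, inner ℝ (x - z) (x - w) = 0

/-- The oriented circle with centre `z` and signed radius `r` (counter-clockwise if `r > 0`,
clockwise if `r < 0`) passes through the point `p` with oriented unit tangent `t`.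
For `r > 0`, in the parametrization `θ ↦ z + r * exp (i θ)` the unit tangent at
`p = z + r * exp (i θ)` is `t = i * exp (i θ)`; reversing the circle reverses the tangent.
For `r = 0` this says `p = z`. -/
def PassesThrough (z : ℂ) (r : ℝ) (p t : ℂ) : Prop :=
  ‖t‖ = 1 ∧ p = z - Complex.I * r * t

/-- The four oriented circles at the corners of a lattice square, listed counter-clockwise from
the lower left corner, pass through the common point `p` with oriented tangents `t`, `i t`, `-t`,
`-i t`. So diagonally opposite circles touch at `p` (from opposite sides if their orientations
agree, from the same side if they differ), and adjacent circles are perpendicular there. -/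
def SquareContact (p : ℂ) (z₀₀ : ℂ) (r₀₀ : ℝ) (z₁₀ : ℂ) (r₁₀ : ℝ) (z₁₁ : ℂ) (r₁₁ : ℝ)
    (z₀₁ : ℂ) (r₀₁ : ℝ) : Prop :=
  ∃ t : ℂ, PassesThrough z₀₀ r₀₀ p t ∧ PassesThrough z₁₀ r₁₀ p (Complex.I * t) ∧
    PassesThrough z₁₁ r₁₁ p (-t) ∧ PassesThrough z₀₁ r₀₁ p (-(Complex.I * t))

/-- Twice the signed area of the triangle `x`, `y`, `w`: positive iff the three points
are in counter-clockwise order, negative iff they are in clockwise order. -/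
noncomputable def orientation (x y w : ℂ) : ℝ :=
  ((starRingEnd ℂ) (y - x) * (w - y)).im

/-- The data of a ring pattern on the square lattice: to the vertex `(m, n)` belongs the ring with
centre `center m n`, signed inner radius `inner m n` and outer radius `outer m n`; `touch m n` is
the touching point that belongs to the square with lower left corner `(m, n)`. -/
structure RingPattern where
  center : ℤ → ℤ → ℂ
  inner : ℤ → ℤ → ℝ
  outer : ℤ → ℤ → ℝ
  touch : ℤ → ℤ → ℂ

namespace RingPattern

/-- The inner circle at `(m, n)` as a point set. -/
def innerCircle (P : RingPattern) (m n : ℤ) : Set ℂ :=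
  Metric.sphere (P.center m n) |P.inner m n|

/-- The outer circle at `(m, n)` as a point set. -/
def outerCircle (P : RingPattern) (m n : ℤ) : Set ℂ :=
  Metric.sphere (P.center m n) (P.outer m n)

/-- The rings at two vertices intersect orthogonally: the outer circle of each of them intersects
the inner circle of the other orthogonally. -/
def RingsOrthogonal (P : RingPattern) (m n k l : ℤ) : Prop :=
  OrthogonalCircles (P.center m n) (P.outer m n) (P.center k l) |P.inner k l| ∧
    OrthogonalCircles (P.center m n) |P.inner m n| (P.center k l) (P.outer k l)

/-- Orthogonal ring patterns on the whole square lattice. -/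
structure IsOrthogonal (P : RingPattern) : Prop where
  outer_pos : ∀ m n, 0 < P.outer m n
  /-- neighbouring rings intersect orthogonally -/
  horizontal : ∀ m n, P.RingsOrthogonal m n (m + 1) n
  vertical : ∀ m n, P.RingsOrthogonal m n m (n + 1)
  /-- in each square the inner circles at the lower left and the upper right corner and the outer
  circles at the two other corners pass through one point, where they touch according to their
  orientations -/
  contact : ∀ m n, SquareContact (P.touch m n)
    (P.center m n) (P.inner m n) (P.center (m + 1) n) (P.outer (m + 1) n)
    (P.center (m + 1) (n + 1)) (P.inner (m + 1) (n + 1)) (P.center m (n + 1)) (P.outer m (n + 1))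
  /-- on the inner circle at `(m, n)`, the second intersection point with the outer circle at
  `(m + 1, n)`, the touching point, and the second intersection point with the outer circle at
  `(m, n + 1)` are in counter-clockwise order if the inner radius is positive and in clockwise
  order if it is negative -/
  orient_inner : ∀ m n, ∀ q ∈ (P.innerCircle m n ∩ P.outerCircle (m + 1) n) \
      P.outerCircle m (n + 1), ∀ q' ∈ (P.innerCircle m n ∩ P.outerCircle m (n + 1)) \
      P.outerCircle (m + 1) n, 0 < P.inner m n * orientation q (P.touch m n) q'
  /-- the same on the outer circle at `(m, n)` with the inner circles at `(m, n + 1)` and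
  `(m - 1, n)`, when the three rings have the same orientation -/
  orient_outer : ∀ m n, 0 < P.inner m n * P.inner m (n + 1) →
    0 < P.inner m n * P.inner (m - 1) n →
    ∀ q ∈ (P.outerCircle m n ∩ P.innerCircle m (n + 1)) \ P.innerCircle (m - 1) n,
    ∀ q' ∈ (P.outerCircle m n ∩ P.innerCircle (m - 1) n) \ P.innerCircle m (n + 1),
      0 < P.inner m n * orientation q (P.touch (m - 1) n) q'

/-- `P` has the `ρ`-radii `ρ` and ring area `π * ℓ ^ 2`. -/
def HasRhoRadii (P : RingPattern) (ℓ : ℝ) (ρ : ℤ → ℤ → ℝ) : Prop :=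
  ∀ m n, P.outer m n = ℓ * Real.cosh (ρ m n) ∧ P.inner m n = ℓ * Real.sinh (ρ m n)

/-- `Q` is the image of `P` under an orientation preserving isometry `z ↦ u z + b`, `|u| = 1`. -/
def Congruent (P Q : RingPattern) : Prop :=
  ∃ u b : ℂ, ‖u‖ = 1 ∧ ∀ m n, Q.center m n = u * P.center m n + b ∧
    Q.touch m n = u * P.touch m n + b ∧ Q.inner m n = P.inner m n ∧ Q.outer m n = P.outer m n

/-- The oriented angle at the vertex `(m, n)` of the cyclic quadrilateral that belongs to the edge
from `(m, n)` to `(m + 1, n)`: the quadrilateral has as its vertices the two centres and the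
touching points in the two squares that are adjacent to the edge. The angle is measured from the
touching point below the edge to the one above it. -/
noncomputable def angleRight (P : RingPattern) (m n : ℤ) : ℝ :=
  Complex.arg ((P.touch m n - P.center m n) / (P.touch m (n - 1) - P.center m n))

/-- The same for the edge from `(m, n)` to `(m, n + 1)`; the angle is measured from the touching
point to the right of the edge to the one to its left. -/
noncomputable def angleUp (P : RingPattern) (m n : ℤ) : ℝ :=
  Complex.arg ((P.touch (m - 1) n - P.center m n) / (P.touch m n - P.center m n))

/-- The family `F δ` of patterns converges, up to orientation preserving isometries of the plane,
to `L` along `l`: centres, touching points and radii converge at each vertex and square. -/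
def ConvergesTo (F : ℝ → RingPattern) (l : Filter ℝ) (L : RingPattern) : Prop :=
  ∃ u b : ℝ → ℂ, (∀ δ, ‖u δ‖ = 1) ∧ ∀ m n,
    Tendsto (fun δ => u δ * (F δ).center m n + b δ) l (𝓝 (L.center m n)) ∧
    Tendsto (fun δ => u δ * (F δ).touch m n + b δ) l (𝓝 (L.touch m n)) ∧
    Tendsto (fun δ => (F δ).inner m n) l (𝓝 (L.inner m n)) ∧
    Tendsto (fun δ => (F δ).outer m n) l (𝓝 (L.outer m n))

end RingPattern

/-- The data of a circle pattern with the combinatorics of the square lattice: a circle for each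
vertex `(m, n)`, and the touching point for each square with lower left corner `(m, n)`. -/
structure CirclePattern where
  center : ℤ → ℤ → ℂ
  radius : ℤ → ℤ → ℝ
  touch : ℤ → ℤ → ℂ

namespace CirclePattern

/-- Schramm's orthogonal circle patterns: circles at neighbouring vertices intersect orthogonally,
the four circles of each square pass through one point, diagonally opposite ones touch there
externally, and the pattern is positively oriented. -/
structure IsOrthogonal (C : CirclePattern) : Prop where
  radius_pos : ∀ m n, 0 < C.radius m n
  horizontal : ∀ m n, OrthogonalCircles (C.center m n) (C.radius m n)
    (C.center (m + 1) n) (C.radius (m + 1) n)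
  vertical : ∀ m n, OrthogonalCircles (C.center m n) (C.radius m n)
    (C.center m (n + 1)) (C.radius m (n + 1))
  contact : ∀ m n, SquareContact (C.touch m n)
    (C.center m n) (C.radius m n) (C.center (m + 1) n) (C.radius (m + 1) n)
    (C.center (m + 1) (n + 1)) (C.radius (m + 1) (n + 1)) (C.center m (n + 1)) (C.radius m (n + 1))

/-- `C` is an orthogonal circle pattern with logarithmic radii `ρ`. -/
def IsOrthogonalWithLogRadii (C : CirclePattern) (ρ : ℤ → ℤ → ℝ) : Prop :=
  C.IsOrthogonal ∧ ∀ m n, C.radius m n = Real.exp (ρ m n)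

/-- `D` is the image of `C` under an orientation preserving isometry `z ↦ u z + b`, `|u| = 1`. -/
def Congruent (C D : CirclePattern) : Prop :=
  ∃ u b : ℂ, ‖u‖ = 1 ∧ ∀ m n, D.center m n = u * C.center m n + b ∧
    D.touch m n = u * C.touch m n + b ∧ D.radius m n = C.radius m n

/-- A circle pattern as a pattern of rings of area zero, oriented counter-clockwise. -/
def toRings (C : CirclePattern) : RingPattern where
  center := C.center
  inner := C.radius
  outer := C.radius
  touch := C.touch

/-- The mirror image of a circle pattern under complex conjugation, as a pattern of rings of area
zero, oriented clockwise. -/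
def mirrorRings (C : CirclePattern) : RingPattern where
  center m n := (starRingEnd ℂ) (C.center m n)
  inner m n := -C.radius m n
  outer := C.radius
  touch m n := (starRingEnd ℂ) (C.touch m n)

/-- The circle pattern `C` with its index lattice reflected by `(m, n) ↦ (-m, n)`, as a pattern of
rings of area zero, oriented clockwise. The square with lower left corner `(m, n)` is reflected to
the one with lower left corner `(-m - 1, n)`. -/
def reflectedRings (C : CirclePattern) : RingPattern where
  center m n := C.center (-m) n
  inner m n := -C.radius (-m) n
  outer m n := C.radius (-m) n
  touch m n := C.touch (-m - 1) n

end CirclePattern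

/-! Let `p` be the touching point of a square and `t` the unit tangent there of the inner circle at
its lower left corner. The contact condition says that the four centres are `p + i r t`, `p - R t`,
`p - i r t`, `p + R t`. A pattern is thus a field of tangents `t` (a frame) together with radii, and
the only constraint is that the two squares adjacent to an edge give it the same vector. For a
horizontal edge this reads `t (m, n) * (R (m+1, n) + i r (m, n)) = t (m, n-1) * (R (m, n) + i r
(m+1, n))`; vertical edges are similar.

For `r = ℓ sinh ρ` and `R = ℓ cosh ρ` the two brackets have equal modulus, and their quotient is
`unitStep` of the increment of `ρ` along the edge (`cosh_add_I_mul_sinh`). The increments of `a m n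
+ δ` are `a n` horizontally and `a m` vertically. The rotation from one square to the next therefore
depends on one coordinate only, and neither on `δ` nor on `ℓ`. This is recorded in `TangentCompat`,
and everything else follows from it.

Existence: `t = exp (i (θ n - θ m))` solves the recursion, and the edge vectors form a closed
one-form, hence have a potential (`exists_frame_of_compat`). Orthogonality and the order of the
touching points hold automatically for a frame (`HasFrame.isOrthogonal`). Uniqueness and limits:
frames with the same `a` differ by a constant rotation, so after that rotation only the radii vary
(`convergesTo_of_radii`). Angles: consecutive radius vectors at a centre have quotient a real
number, with the sign of `r`, times `i * unitStep`. -/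

/-! ### The edge rotation and its argument -/

/-- The unit complex number `(1 + i sinh x) / cosh x`, whose argument is the Gudermannian of `x`. -/
noncomputable def unitStep (x : ℝ) : ℂ :=
  (1 + Complex.I * Real.sinh x) / Real.cosh x

/-- Double-angle formulas for the angle with tangent `exp x`: its double has cosine `-tanh x` and
sine `1 / cosh x`. -/
theorem I_mul_unitStep (x : ℝ) :
    Complex.I * unitStep x = Complex.exp ((2 * Real.arctan (Real.exp x) : ℝ) * Complex.I) := by
  have hE := Real.exp_pos x
  have hc := Real.cosh_pos x
  have key : Real.exp x * Real.exp (-x) = 1 := by rw [← Real.exp_add]; simp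
  have h1 : Real.cos (2 * Real.arctan (Real.exp x)) = - Real.sinh x / Real.cosh x := by
    rw [Real.cos_two_mul, Real.cos_sq_arctan, eq_div_iff hc.ne', Real.cosh_eq, Real.sinh_eq]
    field_simp
    linear_combination (-2 * Real.exp x) * key
  have h2 : Real.sin (2 * Real.arctan (Real.exp x)) = 1 / Real.cosh x := by
    have h3 : Real.sin (Real.arctan (Real.exp x)) =
        Real.exp x * Real.cos (Real.arctan (Real.exp x)) := by
      rw [Real.sin_arctan, Real.cos_arctan]; ring
    rw [Real.sin_two_mul, h3, eq_div_iff hc.ne',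
      show 2 * (Real.exp x * Real.cos (Real.arctan (Real.exp x))) *
        Real.cos (Real.arctan (Real.exp x)) =
        2 * Real.exp x * Real.cos (Real.arctan (Real.exp x)) ^ 2 by ring, Real.cos_sq_arctan,
      Real.cosh_eq]
    field_simp
    linear_combination key
  have hc' : (Real.cosh x : ℂ) ≠ 0 := by exact_mod_cast hc.ne'
  rw [Complex.exp_mul_I, ← Complex.ofReal_cos, ← Complex.ofReal_sin, h1, h2, unitStep]
  simp only [Complex.ofReal_div, Complex.ofReal_neg, Complex.ofReal_one]
  field_simp
  linear_combination (Real.sinh x : ℂ) * Complex.I_sq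

theorem unitStep_eq_exp (x : ℝ) :
    unitStep x =
      Complex.exp ((2 * Real.arctan (Real.exp x) - Real.pi / 2 : ℝ) * Complex.I) := by
  have h := I_mul_unitStep x
  rw [Complex.ofReal_sub, sub_mul, Complex.exp_sub, ← h]
  rw [show ((Real.pi / 2 : ℝ) : ℂ) = (Real.pi : ℂ) / 2 by push_cast; rfl,
    Complex.exp_pi_div_two_mul_I]
  field_simp

theorem norm_unitStep (x : ℝ) : ‖unitStep x‖ = 1 := by
  rw [unitStep_eq_exp, Complex.norm_exp_ofReal_mul_I]

theorem unitStep_mul_conj (x : ℝ) : unitStep x * (starRingEnd ℂ) (unitStep x) = 1 := by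
  rw [Complex.mul_conj, Complex.normSq_eq_norm_sq, norm_unitStep]; simp

/-- The squared modulus `cosh² x + sinh² y = 1 + sinh² x + sinh² y` is symmetric in `x` and `y`, so
the quotient is unimodular; the addition theorems show that it depends on `y - x` alone. -/
theorem cosh_add_I_mul_sinh (x y : ℝ) :
    (Real.cosh x + Complex.I * Real.sinh y : ℂ) =
      unitStep (y - x) * (Real.cosh y + Complex.I * Real.sinh x) := by
  have hc : (Real.cosh (y - x) : ℂ) ≠ 0 := by exact_mod_cast (Real.cosh_pos _).ne'
  have h1 := Real.cosh_add (y - x) x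
  have h2 := Real.sinh_sub y (y - x)
  rw [sub_add_cancel] at h1
  rw [sub_sub_cancel] at h2
  have h1' := congrArg (fun z : ℝ => (z : ℂ)) h1
  have h2' := congrArg (fun z : ℝ => (z : ℂ)) h2
  simp only [Complex.ofReal_add, Complex.ofReal_sub, Complex.ofReal_mul] at h1' h2'
  rw [unitStep, div_mul_eq_mul_div, eq_div_iff hc]
  linear_combination -h1' - Complex.I * h2' -
    (Real.sinh (y - x) : ℂ) * Real.sinh x * Complex.I_sq

theorem exp_add_I_mul_exp (x y : ℝ) :
    (Real.exp x + Complex.I * Real.exp y : ℂ) =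
      unitStep (y - x) * (Real.exp y + Complex.I * Real.exp x) := by
  have hc : (Real.cosh (y - x) : ℂ) ≠ 0 := by exact_mod_cast (Real.cosh_pos _).ne'
  have h1 : Real.exp x * (Real.cosh (y - x) + Real.sinh (y - x)) = Real.exp y := by
    rw [Real.cosh_add_sinh, ← Real.exp_add, add_sub_cancel]
  have h2 : Real.exp y * (Real.cosh (y - x) - Real.sinh (y - x)) = Real.exp x := by
    rw [Real.cosh_sub_sinh, ← Real.exp_add]; congr 1; ring
  have h1' := congrArg (fun z : ℝ => (z : ℂ)) h1
  have h2' := congrArg (fun z : ℝ => (z : ℂ)) h2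
  simp only [Complex.ofReal_add, Complex.ofReal_sub, Complex.ofReal_mul] at h1' h2'
  rw [unitStep, div_mul_eq_mul_div, eq_div_iff hc]
  linear_combination h1' + Complex.I * h2' -
    (Real.sinh (y - x) : ℂ) * Real.exp x * Complex.I_sq

theorem arg_I_mul_unitStep (x : ℝ) :
    Complex.arg (Complex.I * unitStep x) = Real.pi - 2 * Real.arctan (Real.exp (-x)) := by
  have h1 := Real.arctan_inv_of_pos (Real.exp_pos x)
  have h2 := Real.arctan_lt_pi_div_two (Real.exp x)
  have h3 := Real.arctan_pos.2 (Real.exp_pos x)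
  rw [I_mul_unitStep, Complex.arg_exp_mul_I, Real.exp_neg, h1,
    (toIocMod_eq_self Real.two_pi_pos).2 (by constructor <;> linarith)]
  ring

theorem arg_neg_I_mul_unitStep (x : ℝ) :
    Complex.arg (-(Complex.I * unitStep x)) = -(2 * Real.arctan (Real.exp (-x))) := by
  have h1 := Real.arctan_inv_of_pos (Real.exp_pos x)
  have h2 := Real.arctan_lt_pi_div_two (Real.exp x)
  have h3 := Real.arctan_pos.2 (Real.exp_pos x)
  -- The sign is absorbed as a rotation by `-π` rather than `π`, which keeps the angle in the
  -- principal range.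
  have h4 : -(Complex.I * unitStep x) =
      Complex.exp ((2 * Real.arctan (Real.exp x) - Real.pi : ℝ) * Complex.I) := by
    rw [I_mul_unitStep, Complex.ofReal_sub, sub_mul, Complex.exp_sub, Complex.exp_pi_mul_I,
      div_neg, div_one]
  rw [h4, Complex.arg_exp_mul_I, Real.exp_neg, h1,
    (toIocMod_eq_self Real.two_pi_pos).2 (by constructor <;> linarith)]
  ring

/-! ### Compatibility of the radii along edges -/

/-- Radii functions on the lattice for which the edge vectors seen from the two squares adjacent
to an edge differ by the rotation `unitStep`, depending on one coordinate only. -/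
structure TangentCompat (a : ℝ) (r R : ℤ → ℤ → ℝ) : Prop where
  outer_pos : ∀ m n, 0 < R m n
  horizontal : ∀ m n : ℤ, (R m n + Complex.I * r (m + 1) n : ℂ) =
    unitStep (a * (n : ℝ)) * (R (m + 1) n + Complex.I * r m n)
  vertical : ∀ m n : ℤ, (R m n + Complex.I * r m (n + 1) : ℂ) =
    unitStep (a * (m : ℝ)) * (R m (n + 1) + Complex.I * r m n)

theorem tangentCompat_cosh_sinh (a δ : ℝ) {ℓ : ℝ} (hℓ : 0 < ℓ) :
    TangentCompat a (fun m n => ℓ * Real.sinh (a * (m : ℝ) * (n : ℝ) + δ))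
      (fun m n => ℓ * Real.cosh (a * (m : ℝ) * (n : ℝ) + δ)) := by
  refine ⟨fun m n => mul_pos hℓ (Real.cosh_pos _), fun m n => ?_, fun m n => ?_⟩
  · have h := cosh_add_I_mul_sinh (a * (m : ℝ) * (n : ℝ) + δ)
      (a * ((m + 1 : ℤ) : ℝ) * (n : ℝ) + δ)
    rw [show a * ((m + 1 : ℤ) : ℝ) * (n : ℝ) + δ - (a * (m : ℝ) * (n : ℝ) + δ) = a * (n : ℝ) by
      push_cast; ring] at h
    rw [Complex.ofReal_mul, Complex.ofReal_mul, Complex.ofReal_mul, Complex.ofReal_mul]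
    linear_combination (ℓ : ℂ) * h
  · have h := cosh_add_I_mul_sinh (a * (m : ℝ) * (n : ℝ) + δ)
      (a * (m : ℝ) * ((n + 1 : ℤ) : ℝ) + δ)
    rw [show a * (m : ℝ) * ((n + 1 : ℤ) : ℝ) + δ - (a * (m : ℝ) * (n : ℝ) + δ) = a * (m : ℝ) by
      push_cast; ring] at h
    rw [Complex.ofReal_mul, Complex.ofReal_mul, Complex.ofReal_mul, Complex.ofReal_mul]
    linear_combination (ℓ : ℂ) * h

theorem tangentCompat_exp (a : ℝ) :
    TangentCompat a (fun m n => Real.exp (a * (m : ℝ) * (n : ℝ)))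
      (fun m n => Real.exp (a * (m : ℝ) * (n : ℝ))) := by
  refine ⟨fun m n => Real.exp_pos _, fun m n => ?_, fun m n => ?_⟩
  · have h := exp_add_I_mul_exp (a * (m : ℝ) * (n : ℝ)) (a * ((m + 1 : ℤ) : ℝ) * (n : ℝ))
    rwa [show a * ((m + 1 : ℤ) : ℝ) * (n : ℝ) - a * (m : ℝ) * (n : ℝ) = a * (n : ℝ) by
      push_cast; ring] at h
  · have h := exp_add_I_mul_exp (a * (m : ℝ) * (n : ℝ)) (a * (m : ℝ) * ((n + 1 : ℤ) : ℝ))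
    rwa [show a * (m : ℝ) * ((n + 1 : ℤ) : ℝ) - a * (m : ℝ) * (n : ℝ) = a * (m : ℝ) by
      push_cast; ring] at h

/-- The rotations do not involve the parameter, so the edge identities survive the limit. This also
covers the clockwise limit, with its negative inner radii. -/
theorem TangentCompat.of_tendsto {a : ℝ} {l : Filter ℝ} [NeBot l] {r R : ℝ → ℤ → ℤ → ℝ}
    {r' R' : ℤ → ℤ → ℝ} (h : ∀ δ, TangentCompat a (r δ) (R δ)) (hR' : ∀ m n, 0 < R' m n)
    (hr : ∀ m n, Tendsto (fun δ => r δ m n) l (𝓝 (r' m n)))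
    (hR : ∀ m n, Tendsto (fun δ => R δ m n) l (𝓝 (R' m n))) : TangentCompat a r' R' := by
  have hz : ∀ m n k j, Tendsto (fun δ => (R δ m n + Complex.I * r δ k j : ℂ)) l
      (𝓝 (R' m n + Complex.I * r' k j)) := fun m n k j =>
    ((Complex.continuous_ofReal.tendsto _).comp (hR m n)).add
      (((Complex.continuous_ofReal.tendsto _).comp (hr k j)).const_mul _)
  refine ⟨hR', fun m n => ?_, fun m n => ?_⟩
  · refine tendsto_nhds_unique (hz m n (m + 1) n) ?_
    simp only [fun δ => (h δ).horizontal m n]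
    exact (hz _ _ _ _).const_mul _
  · refine tendsto_nhds_unique (hz m n m (n + 1)) ?_
    simp only [fun δ => (h δ).vertical m n]
    exact (hz _ _ _ _).const_mul _

/-! ### Limits of the scaled radii -/

theorem tendsto_cosh_sinh_atTop (ρ : ℝ) :
    Tendsto (fun δ => 2 * Real.exp (-|δ|) * Real.cosh (ρ + δ)) atTop (𝓝 (Real.exp ρ)) ∧
    Tendsto (fun δ => 2 * Real.exp (-|δ|) * Real.sinh (ρ + δ)) atTop (𝓝 (Real.exp ρ)) := by
  -- For `δ ≥ 0` the scaled radii are exactly `exp ρ ± exp (-ρ - 2 δ)`.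
  have h0 : Tendsto (fun δ : ℝ => Real.exp (-ρ - 2 * δ)) atTop (𝓝 0) :=
    Real.tendsto_exp_atBot.comp
      (tendsto_atBot_add_const_left _ _ (tendsto_neg_atTop_atBot.comp
        (tendsto_id.const_mul_atTop (by norm_num : (0 : ℝ) < 2))))
  constructor
  · have h := (tendsto_const_nhds (x := Real.exp ρ)).add h0
    rw [add_zero] at h
    refine h.congr' ?_
    filter_upwards [eventually_ge_atTop 0] with δ hδ
    rw [abs_of_nonneg hδ, Real.cosh_eq,
      show 2 * Real.exp (-δ) * ((Real.exp (ρ + δ) + Real.exp (-(ρ + δ))) / 2) =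
        Real.exp (-δ) * Real.exp (ρ + δ) + Real.exp (-δ) * Real.exp (-(ρ + δ)) by ring,
      ← Real.exp_add, ← Real.exp_add]
    congr 2 <;> ring
  · have h := (tendsto_const_nhds (x := Real.exp ρ)).sub h0
    rw [sub_zero] at h
    refine h.congr' ?_
    filter_upwards [eventually_ge_atTop 0] with δ hδ
    rw [abs_of_nonneg hδ, Real.sinh_eq,
      show 2 * Real.exp (-δ) * ((Real.exp (ρ + δ) - Real.exp (-(ρ + δ))) / 2) =
        Real.exp (-δ) * Real.exp (ρ + δ) - Real.exp (-δ) * Real.exp (-(ρ + δ)) by ring,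
      ← Real.exp_add, ← Real.exp_add]
    congr 2 <;> ring

theorem tendsto_cosh_sinh_atBot (ρ : ℝ) :
    Tendsto (fun δ => 2 * Real.exp (-|δ|) * Real.cosh (ρ + δ)) atBot (𝓝 (Real.exp (-ρ))) ∧
    Tendsto (fun δ => 2 * Real.exp (-|δ|) * Real.sinh (ρ + δ)) atBot
      (𝓝 (-Real.exp (-ρ))) := by
  obtain ⟨h1, h2⟩ := tendsto_cosh_sinh_atTop (-ρ)
  constructor
  · refine (h1.comp tendsto_neg_atBot_atTop).congr fun δ => ?_
    simp only [Function.comp, abs_neg]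
    rw [← neg_add, Real.cosh_neg]
  · refine (h2.comp tendsto_neg_atBot_atTop).neg.congr fun δ => ?_
    simp only [Function.comp, abs_neg]
    rw [← neg_add, Real.sinh_neg]
    ring

/-! ### Induction and summation on the lattice -/

theorem int_lattice_induction {p : ℤ → ℤ → Prop} (h0 : p 0 0)
    (hx : ∀ m n, p m n ↔ p (m + 1) n) (hy : ∀ m n, p m n ↔ p m (n + 1)) : ∀ m n, p m n := by
  have h1 : ∀ m, p m 0 := by
    intro m
    induction m with
    | zero => exact h0
    | succ i ih => exact (hx _ _).1 ih
    | pred i ih => rw [hx, sub_add_cancel]; exact ih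
  intro m n
  induction n with
  | zero => exact h1 m
  | succ i ih => exact (hy _ _).1 ih
  | pred i ih => rw [hy, sub_add_cancel]; exact ih

theorem exists_antidifference {G : Type*} [AddCommGroup G] (f : ℤ → G) :
    ∃ F : ℤ → G, F 0 = 0 ∧ ∀ n, F (n + 1) = F n + f n := by
  -- `Int.toNat` truncates at zero, so at most one of the two sums is nonempty.
  refine ⟨fun n => ∑ i ∈ Finset.range n.toNat, f i -
    ∑ i ∈ Finset.range (-n).toNat, f (-(i : ℤ) - 1), by simp, fun n => ?_⟩
  rcases le_or_gt 0 n with hn | hn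
  · obtain ⟨k, rfl⟩ := Int.eq_ofNat_of_zero_le hn
    have h1 : ((k : ℤ) + 1).toNat = k + 1 := by omega
    have h2 : (-((k : ℤ) + 1)).toNat = 0 := by omega
    have h3 : (-(k : ℤ)).toNat = 0 := by omega
    simp only [h1, h2, h3, Int.toNat_natCast, Finset.sum_range_succ, Finset.sum_range_zero]
    abel
  · obtain ⟨k, hk⟩ := Int.eq_ofNat_of_zero_le (show 0 ≤ -n - 1 by omega)
    have h1 : (n + 1).toNat = 0 := by omega
    have h2 : (-(n + 1)).toNat = k := by omega
    have h3 : (-n).toNat = k + 1 := by omega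
    have h4 : n.toNat = 0 := by omega
    have h5 : -(k : ℤ) - 1 = n := by omega
    simp only [h1, h2, h3, h4, h5, Finset.sum_range_succ, Finset.sum_range_zero]
    abel

/-- A discrete closed one-form on the square lattice is exact. -/
theorem exists_lattice_potential {G : Type*} [AddCommGroup G] (h v : ℤ → ℤ → G)
    (hv : ∀ m n, h m n + v (m + 1) n = v m n + h m (n + 1)) :
    ∃ z : ℤ → ℤ → G, (∀ m n, z (m + 1) n = z m n + h m n) ∧
      ∀ m n, z m (n + 1) = z m n + v m n := by
  obtain ⟨H, -, hH⟩ := exists_antidifference fun m => h m 0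
  choose V hV0 hV using fun m => exists_antidifference (v m)
  refine ⟨fun m n => H m + V m n, fun m n => ?_, fun m n => by simp only [hV]; abel⟩
  -- Closedness makes the horizontal relation in one row equivalent to that in the next; it holds in
  -- row `0` by the choice of `H`.
  have key : ∀ n, V (m + 1) n + h m 0 = V m n + h m n := by
    intro n
    have step : ∀ k, V (m + 1) k + h m 0 = V m k + h m k ↔
        V (m + 1) (k + 1) + h m 0 = V m (k + 1) + h m (k + 1) := by
      intro k
      have e : V (m + 1) (k + 1) + h m 0 - (V m (k + 1) + h m (k + 1)) =
          V (m + 1) k + h m 0 - (V m k + h m k) +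
            (h m k + v (m + 1) k - (v m k + h m (k + 1))) := by
        rw [hV, hV]; abel
      rw [hv, sub_self, add_zero] at e
      rw [← sub_eq_zero, ← e, sub_eq_zero]
    induction n with
    | zero => simp [hV0]
    | succ i ih => exact (step _).1 ih
    | pred i ih => rw [step, sub_add_cancel]; exact ih
  have e := key n
  calc H (m + 1) + V (m + 1) n = H m + (V (m + 1) n + h m 0) := by rw [hH]; abel
    _ = H m + V m n + h m n := by rw [e]; abel

/-! ### Frames of tangents -/

namespace RingPattern

/-- `t m n` is the oriented unit tangent, at the touching point of the square with lower left
corner `(m, n)`, of the inner circle at that corner. -/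
structure HasFrame (P : RingPattern) (t : ℤ → ℤ → ℂ) : Prop where
  norm_eq : ∀ m n, ‖t m n‖ = 1
  center₀₀ : ∀ m n, P.center m n = P.touch m n + Complex.I * P.inner m n * t m n
  center₁₀ : ∀ m n, P.center (m + 1) n = P.touch m n - P.outer (m + 1) n * t m n
  center₁₁ : ∀ m n, P.center (m + 1) (n + 1) =
    P.touch m n - Complex.I * P.inner (m + 1) (n + 1) * t m n
  center₀₁ : ∀ m n, P.center m (n + 1) = P.touch m n + P.outer m (n + 1) * t m n

/-- The contact condition of `IsOrthogonal`, in all squares. -/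
def HasContact (P : RingPattern) : Prop :=
  ∀ m n, SquareContact (P.touch m n)
    (P.center m n) (P.inner m n) (P.center (m + 1) n) (P.outer (m + 1) n)
    (P.center (m + 1) (n + 1)) (P.inner (m + 1) (n + 1)) (P.center m (n + 1)) (P.outer m (n + 1))

theorem HasContact.exists_frame {P : RingPattern} (h : P.HasContact) : ∃ t, P.HasFrame t := by
  choose t h₀₀ h₁₀ h₁₁ h₀₁ using h
  refine ⟨t, fun m n => (h₀₀ m n).1, fun m n => ?_, fun m n => ?_, fun m n => ?_, fun m n => ?_⟩
  · linear_combination -(h₀₀ m n).2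
  · linear_combination -(h₁₀ m n).2 + P.outer (m + 1) n * t m n * Complex.I_sq
  · linear_combination -(h₁₁ m n).2
  · linear_combination -(h₀₁ m n).2 - P.outer m (n + 1) * t m n * Complex.I_sq

theorem HasFrame.hasContact {P : RingPattern} {t : ℤ → ℤ → ℂ} (h : P.HasFrame t) :
    P.HasContact := by
  intro m n
  have ht := h.norm_eq m n
  refine ⟨t m n, ⟨ht, ?_⟩, ⟨by simp [ht], ?_⟩, ⟨by simp [ht], ?_⟩, ⟨by simp [ht], ?_⟩⟩
  · linear_combination -h.center₀₀ m n
  · linear_combination -h.center₁₀ m n + P.outer (m + 1) n * t m n * Complex.I_sq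
  · linear_combination -h.center₁₁ m n
  · linear_combination -h.center₀₁ m n - P.outer m (n + 1) * t m n * Complex.I_sq

namespace HasFrame

variable {P : RingPattern} {t : ℤ → ℤ → ℂ} {a : ℝ}

theorem center_add_one_left (h : P.HasFrame t) (m n : ℤ) : P.center (m + 1) n =
    P.center m n - t m n * (P.outer (m + 1) n + Complex.I * P.inner m n) := by
  rw [h.center₁₀, h.center₀₀]; ring

theorem center_add_one_right (h : P.HasFrame t) (m n : ℤ) : P.center m (n + 1) =
    P.center m n + t m n * (P.outer m (n + 1) - Complex.I * P.inner m n) := by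
  rw [h.center₀₁, h.center₀₀]; ring

/-- The top edge of the square `(m, n)` is the bottom edge of `(m, n + 1)`. Equating its two
expressions and cancelling a factor with real part `R > 0` leaves the rotation. -/
theorem frame_add_one_right (h : P.HasFrame t) (hP : TangentCompat a P.inner P.outer)
    (m n : ℤ) : t m (n + 1) = unitStep (a * ((n + 1 : ℤ) : ℝ)) * t m n := by
  have hne : (P.outer (m + 1) (n + 1) + Complex.I * P.inner m (n + 1) : ℂ) ≠ 0 := by
    intro h0
    have := congrArg Complex.re h0
    simp at this
    exact (hP.outer_pos _ _).ne' this
  refine mul_right_cancel₀ hne ?_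
  have h1 := h.center_add_one_left m (n + 1)
  rw [h.center₁₁, h.center₀₁] at h1
  linear_combination h1 + t m n * hP.horizontal m (n + 1)

theorem frame_add_one_left (h : P.HasFrame t) (hP : TangentCompat a P.inner P.outer)
    (m n : ℤ) : t m n = unitStep (a * ((m + 1 : ℤ) : ℝ)) * t (m + 1) n := by
  have hne : (P.outer (m + 1) (n + 1) - Complex.I * P.inner (m + 1) n : ℂ) ≠ 0 := by
    intro h0
    have := congrArg Complex.re h0
    simp at this
    exact (hP.outer_pos _ _).ne' this
  -- Vertical edge vectors carry `R - i r`, so the conjugate of the compatibility identity is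
  -- needed, with the inverse rotation.
  have hc := congrArg (starRingEnd ℂ) (hP.vertical (m + 1) n)
  simp only [map_add, map_mul, Complex.conj_ofReal, Complex.conj_I] at hc
  refine mul_right_cancel₀ hne ?_
  have h1 := h.center_add_one_right (m + 1) n
  rw [h.center₁₁, h.center₁₀] at h1
  linear_combination unitStep (a * ((m + 1 : ℤ) : ℝ)) * (h1 - t m n * hc) -
    t m n * (P.outer (m + 1) (n + 1) - Complex.I * P.inner (m + 1) n) *
      unitStep_mul_conj (a * ((m + 1 : ℤ) : ℝ))

theorem frame_ne_zero (h : P.HasFrame t) (m n : ℤ) : t m n ≠ 0 := by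
  rw [← norm_ne_zero_iff, h.norm_eq]; exact one_ne_zero

/-- Two frames with the same steps are proportional. -/
theorem frame_proportional {Q : RingPattern} {s : ℤ → ℤ → ℂ} (h : P.HasFrame t)
    (hP : TangentCompat a P.inner P.outer) (hs : Q.HasFrame s)
    (hQ : TangentCompat a Q.inner Q.outer) :
    ∀ m n, s 0 0 / t 0 0 * t m n = s m n := by
  have hE : ∀ x, unitStep x ≠ 0 := fun x => by
    rw [← norm_ne_zero_iff, norm_unitStep]; exact one_ne_zero
  have h0 : s 0 0 / t 0 0 * t 0 0 = s 0 0 := div_mul_cancel₀ _ (h.frame_ne_zero 0 0)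
  generalize s 0 0 / t 0 0 = u at h0 ⊢
  refine int_lattice_induction h0 (fun m n => ?_) fun m n => ?_
  · rw [h.frame_add_one_left hP m n, hs.frame_add_one_left hQ m n, mul_left_comm]
    exact mul_right_inj' (hE _)
  · rw [h.frame_add_one_right hP, hs.frame_add_one_right hQ, mul_left_comm]
    exact (mul_right_inj' (hE _)).symm

end HasFrame

/-! ### Convergence, uniqueness and existence -/

/-- All frames involved obey the recursion determined by `a`, so a rotation and a translation match
the frame and the centre at the origin exactly. Any other centre is then reached by finitely many
edge vectors, each continuous in the radii. -/
theorem convergesTo_of_radii {F : ℝ → RingPattern} {l : Filter ℝ} [NeBot l] {L : RingPattern}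
    (a : ℝ) (hF : ∀ δ, (F δ).HasContact) (hFc : ∀ δ, TangentCompat a (F δ).inner (F δ).outer)
    (hL : L.HasContact) (hpos : ∀ m n, 0 < L.outer m n)
    (hr : ∀ m n, Tendsto (fun δ => (F δ).inner m n) l (𝓝 (L.inner m n)))
    (hR : ∀ m n, Tendsto (fun δ => (F δ).outer m n) l (𝓝 (L.outer m n))) :
    ConvergesTo F l L := by
  have hLc : TangentCompat a L.inner L.outer := .of_tendsto hFc hpos hr hR
  choose t ht using fun δ => (hF δ).exists_frame
  obtain ⟨s, hs⟩ := hL.exists_frame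
  set u : ℝ → ℂ := fun δ => s 0 0 / t δ 0 0
  have hut : ∀ δ m n, u δ * t δ m n = s m n := fun δ =>
    (ht δ).frame_proportional (hFc δ) hs hLc
  have hrc : ∀ m n, Tendsto (fun δ => ((F δ).inner m n : ℂ)) l (𝓝 (L.inner m n)) :=
    fun m n => (Complex.continuous_ofReal.tendsto _).comp (hr m n)
  have hRc : ∀ m n, Tendsto (fun δ => ((F δ).outer m n : ℂ)) l (𝓝 (L.outer m n)) :=
    fun m n => (Complex.continuous_ofReal.tendsto _).comp (hR m n)
  set b : ℝ → ℂ := fun δ => L.center 0 0 - u δ * (F δ).center 0 0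
  have hcenter : ∀ m n, Tendsto (fun δ => u δ * (F δ).center m n + b δ) l
      (𝓝 (L.center m n)) := by
    refine int_lattice_induction (by simp [b]) (fun m n => ?_) fun m n => ?_
    · have e : Tendsto (fun δ => s m n * ((F δ).outer (m + 1) n + Complex.I * (F δ).inner m n))
          l (𝓝 (s m n * (L.outer (m + 1) n + Complex.I * L.inner m n))) :=
        ((hRc _ _).add ((hrc _ _).const_mul _)).const_mul _
      constructor <;> intro hc
      · rw [hs.center_add_one_left]
        refine (hc.sub e).congr fun δ => ?_
        rw [(ht δ).center_add_one_left, ← hut δ m n]; ring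
      · have := hc.add e
        rw [hs.center_add_one_left, sub_add_cancel] at this
        refine this.congr fun δ => ?_
        rw [(ht δ).center_add_one_left, ← hut δ m n]; ring
    · have e : Tendsto (fun δ => s m n * ((F δ).outer m (n + 1) - Complex.I * (F δ).inner m n))
          l (𝓝 (s m n * (L.outer m (n + 1) - Complex.I * L.inner m n))) :=
        ((hRc _ _).sub ((hrc _ _).const_mul _)).const_mul _
      constructor <;> intro hc
      · rw [hs.center_add_one_right]
        refine (hc.add e).congr fun δ => ?_
        rw [(ht δ).center_add_one_right, ← hut δ m n]; ring
      · have := hc.sub e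
        rw [hs.center_add_one_right, add_sub_cancel_right] at this
        refine this.congr fun δ => ?_
        rw [(ht δ).center_add_one_right, ← hut δ m n]; ring
  refine ⟨u, b, fun δ => ?_, fun m n => ⟨hcenter m n, ?_, hr m n, hR m n⟩⟩
  · rw [norm_div, hs.norm_eq, (ht δ).norm_eq, div_one]
  · have := (hcenter m n).sub (((hrc m n).const_mul Complex.I).mul_const (s m n))
    rw [hs.center₀₀, add_sub_cancel_right] at this
    refine this.congr fun δ => ?_
    rw [(ht δ).center₀₀, ← hut δ m n]; ring

theorem congruent_of_radii {P Q : RingPattern} (a : ℝ) (hP : P.HasContact)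
    (hPc : TangentCompat a P.inner P.outer) (hQ : Q.HasContact) (hr : Q.inner = P.inner)
    (hR : Q.outer = P.outer) : P.Congruent Q := by
  -- Uniqueness is convergence of a constant family: along `pure 0` the limit is the value at `0`.
  obtain ⟨u, b, hu, h⟩ := convergesTo_of_radii (F := fun _ => P) (l := pure 0) (L := Q) a
    (fun _ => hP) (fun _ => hPc) hQ (hR ▸ hPc.outer_pos)
    (fun m n => hr ▸ tendsto_const_nhds) (fun m n => hR ▸ tendsto_const_nhds)
  refine ⟨u 0, b 0, hu 0, fun m n => ⟨?_, ?_, by rw [hr], by rw [hR]⟩⟩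
  · exact tendsto_nhds_unique (h m n).1 (tendsto_pure_nhds _ _)
  · exact tendsto_nhds_unique (h m n).2.1 (tendsto_pure_nhds _ _)

theorem exists_frame_of_compat {a : ℝ} {r R : ℤ → ℤ → ℝ} (hc : TangentCompat a r R) :
    ∃ (P : RingPattern) (t : ℤ → ℤ → ℂ), P.inner = r ∧ P.outer = R ∧ P.HasFrame t := by
  -- The squares in rows `n` and `n + 1` share edges in row `n + 1`, hence the shift. Columns obey
  -- the same recursion with the inverse rotation, so one function `θ` serves both directions.
  obtain ⟨θ, -, hθ⟩ := exists_antidifference fun n : ℤ =>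
    2 * Real.arctan (Real.exp (a * ((n + 1 : ℤ) : ℝ))) - Real.pi / 2
  set t : ℤ → ℤ → ℂ := fun m n => Complex.exp ((θ n - θ m : ℝ) * Complex.I) with ht
  have hty : ∀ m n, t m (n + 1) = unitStep (a * ((n + 1 : ℤ) : ℝ)) * t m n := fun m n => by
    simp only [ht]
    rw [unitStep_eq_exp, ← Complex.exp_add, hθ]
    congr 1
    push_cast
    ring
  have htx : ∀ m n, t m n = unitStep (a * ((m + 1 : ℤ) : ℝ)) * t (m + 1) n := fun m n => by
    simp only [ht]
    rw [unitStep_eq_exp, ← Complex.exp_add, hθ]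
    congr 1
    push_cast
    ring
  -- The bottom and left edges are written in the square's own frame, the top and right ones in the
  -- frames of its neighbours; compatibility brings the latter back, and the four vectors then
  -- cancel.
  obtain ⟨z, hzx, hzy⟩ := exists_lattice_potential
    (fun m n => -(t m n * (R (m + 1) n + Complex.I * r m n)))
    (fun m n => t m n * (R m (n + 1) - Complex.I * r m n)) fun m n => by
      have h1 := hc.horizontal m (n + 1)
      have h2 := congrArg (starRingEnd ℂ) (hc.vertical (m + 1) n)
      simp only [map_add, map_mul, Complex.conj_ofReal, Complex.conj_I] at h2
      rw [hty]
      have h3 : (starRingEnd ℂ) (unitStep (a * ((m + 1 : ℤ) : ℝ))) * t m n = t (m + 1) n := by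
        rw [htx m n]
        linear_combination t (m + 1) n * unitStep_mul_conj (a * ((m + 1 : ℤ) : ℝ))
      rw [← h3]
      linear_combination -t m n * h1 - t m n * h2
  refine ⟨⟨z, r, R, fun m n => z m n - Complex.I * r m n * t m n⟩, t, rfl, rfl, ?_, ?_, ?_, ?_, ?_⟩
  · intro m n; exact Complex.norm_exp_ofReal_mul_I _
  · intro m n; dsimp only; ring
  · intro m n; dsimp only; rw [hzx]; ring
  · intro m n
    dsimp only
    rw [hzx, hzy, hty]
    linear_combination t m n * hc.horizontal m (n + 1)
  · intro m n; dsimp only; rw [hzy]; ring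

end RingPattern

/-! ### Orthogonality and orientation from a single common point -/

/-- Perpendicular radii at one point mean `|z - w|² = a² + b²`, and by the law of cosines this
forces them at every common point. -/
theorem orthogonalCircles_of_inner_eq_zero {z w p : ℂ} {a b : ℝ} (hz : ‖p - z‖ = a)
    (hw : ‖p - w‖ = b) (h : inner ℝ (p - z) (p - w) = 0) : OrthogonalCircles z a w b := by
  refine ⟨⟨p, by simpa [dist_eq_norm] using hz, by simpa [dist_eq_norm] using hw⟩, ?_⟩
  rintro x ⟨hxz, hxw⟩
  rw [mem_sphere_iff_norm] at hxz hxw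
  have h1 := norm_sub_sq_real (p - z) (p - w)
  have h2 := norm_sub_sq_real (x - z) (x - w)
  rw [sub_sub_sub_cancel_left] at h1 h2
  rw [hz, hw, h] at h1
  rw [hxz, hxw, h1] at h2
  linarith

/-- Circles with perpendicular radius vectors `-(x t)` and `i y t` at a common point. -/
theorem orthogonalCircles_of_radius_vectors {z w p t : ℂ} {x y : ℝ} (ht : ‖t‖ = 1)
    (hz : z = p + x * t) (hw : w = p + Complex.I * y * t) :
    OrthogonalCircles z |x| w |y| := by
  refine orthogonalCircles_of_inner_eq_zero (p := p) ?_ ?_ ?_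
  · rw [hz, sub_add_cancel_left, norm_neg, norm_mul, ht, Complex.norm_real, mul_one,
      Real.norm_eq_abs]
  · rw [hw, sub_add_cancel_left, norm_neg, norm_mul, norm_mul, ht, Complex.norm_real,
      Complex.norm_I, mul_one, one_mul, Real.norm_eq_abs]
  · rw [hz, hw, sub_add_cancel_left, sub_add_cancel_left, Complex.inner]
    simp
    ring

theorem OrthogonalCircles.symm {z w : ℂ} {a b : ℝ} (h : OrthogonalCircles z a w b) :
    OrthogonalCircles w b z a := by
  refine ⟨Set.inter_comm _ _ ▸ h.1, fun x hx => ?_⟩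
  rw [real_inner_comm]
  exact h.2 x hx.symm

/-- In the coordinates given by a point `p` of a circle and the unit vector `t`, the circle has
the equation `|w|² = 2 ⟨w, c⟩`. -/
theorem normSq_eq_of_norm_sub_eq {p t w c : ℂ} (ht : ‖t‖ = 1)
    (h : ‖p + w * t - (p + c * t)‖ = ‖c‖) :
    w.re ^ 2 + w.im ^ 2 = 2 * (w.re * c.re + w.im * c.im) := by
  have h1 : ‖w - c‖ = ‖c‖ := by
    rw [← h, add_sub_add_left_eq_sub, ← sub_mul, norm_mul, ht, mul_one]
  have h2 : ‖w - c‖ ^ 2 = ‖c‖ ^ 2 := by rw [h1]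
  rw [← Complex.normSq_eq_norm_sq, ← Complex.normSq_eq_norm_sq, Complex.normSq_apply,
    Complex.normSq_apply, Complex.sub_re, Complex.sub_im] at h2
  linarith

theorem orientation_add_mul {p t w w' : ℂ} (ht : ‖t‖ = 1) :
    orientation (p + w * t) p (p + w' * t) = w.im * w'.re - w.re * w'.im := by
  have h : (starRingEnd ℂ) (p - (p + w * t)) * (p + w' * t - p) =
      -((starRingEnd ℂ) w * w') := by
    have h1 : t * (starRingEnd ℂ) t = 1 := by
      rw [Complex.mul_conj, Complex.normSq_eq_norm_sq, ht]; simp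
    rw [sub_add_cancel_left, add_sub_cancel_left, map_neg, map_mul]
    linear_combination -((starRingEnd ℂ) w * w') * h1
  rw [orientation, h]
  simp
  ring

theorem exists_eq_add_mul {t : ℂ} (ht : ‖t‖ = 1) (p q : ℂ) : ∃ w, q = p + w * t := by
  have h0 : t ≠ 0 := by rw [← norm_ne_zero_iff, ht]; exact one_ne_zero
  exact ⟨(q - p) / t, by rw [div_mul_cancel₀ _ h0, add_sub_cancel]⟩

theorem sq_add_sq_pos_of_add_mul_ne {p t w : ℂ} (h : p + w * t ≠ p) :
    0 < w.re ^ 2 + w.im ^ 2 := by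
  have hw : w ≠ 0 := fun h0 => h (by rw [h0]; ring)
  have := Complex.normSq_pos.2 hw
  rw [Complex.normSq_apply] at this
  linarith

/-- A circle with centre `p + i r t` and the circles with centres `p - R₁ t` and `p + R₂ t`, all
through `p`: the second intersection points and `p` are ordered according to the sign of `r`. -/
theorem orientation_inner_pos {p t q q' : ℂ} {r R₁ R₂ : ℝ} (ht : ‖t‖ = 1) (hR₁ : 0 < R₁)
    (hR₂ : 0 < R₂) (hq : ‖q - (p + Complex.I * r * t)‖ = |r|)
    (hq₁ : ‖q - (p - R₁ * t)‖ = R₁) (hqp : q ≠ p)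
    (hq' : ‖q' - (p + Complex.I * r * t)‖ = |r|) (hq₂ : ‖q' - (p + R₂ * t)‖ = R₂)
    (hqp' : q' ≠ p) : 0 < r * orientation q p q' := by
  obtain ⟨w, rfl⟩ := exists_eq_add_mul ht p q
  obtain ⟨w', rfl⟩ := exists_eq_add_mul ht p q'
  have h0 := sq_add_sq_pos_of_add_mul_ne hqp
  have h0' := sq_add_sq_pos_of_add_mul_ne hqp'
  have h1 := normSq_eq_of_norm_sub_eq (c := Complex.I * r) ht (by rw [hq]; simp)
  have h2 := normSq_eq_of_norm_sub_eq (c := -(R₁ : ℂ)) (p := p) (w := w) ht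
    (by rw [neg_mul, ← sub_eq_add_neg, hq₁]; simp [abs_of_pos hR₁])
  have h3 := normSq_eq_of_norm_sub_eq (c := Complex.I * r) ht (by rw [hq']; simp)
  have h4 := normSq_eq_of_norm_sub_eq (c := (R₂ : ℂ)) ht (by rw [hq₂]; simp [abs_of_pos hR₂])
  simp at h1 h2 h3 h4
  rw [orientation_add_mul ht]
  have hx : w.re < 0 := by
    by_contra! hx
    have := mul_nonneg hx hR₁.le
    linarith
  have hx' : 0 < w'.re := by
    by_contra! hx
    have := mul_nonneg (neg_nonneg.2 hx) hR₂.le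
    linarith
  -- The circle equations give `r * w.im = -R₁ * w.re` and `r * w'.im = R₂ * w'.re`.
  have e : r * (w.im * w'.re - w.re * w'.im) = (R₁ + R₂) * (-w.re * w'.re) := by
    linear_combination (w'.re / 2) * (h2 - h1) - (w.re / 2) * (h4 - h3)
  rw [e]
  exact mul_pos (add_pos hR₁ hR₂) (mul_pos (neg_pos.2 hx) hx')

/-- A circle with centre `p - R t` and the circles with centres `p - i r₁ t` and `p + i r₂ t`, all
through `p`: the second intersection points and `p` are ordered according to the sign of `r`. -/
theorem orientation_outer_pos {p t q q' : ℂ} {r r₁ r₂ R : ℝ} (ht : ‖t‖ = 1) (hR : 0 < R)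
    (hr₁ : 0 < r * r₁) (hr₂ : 0 < r * r₂) (hq : ‖q - (p - R * t)‖ = R)
    (hq₁ : ‖q - (p - Complex.I * r₁ * t)‖ = |r₁|) (hqp : q ≠ p)
    (hq' : ‖q' - (p - R * t)‖ = R) (hq₂ : ‖q' - (p + Complex.I * r₂ * t)‖ = |r₂|)
    (hqp' : q' ≠ p) : 0 < r * orientation q p q' := by
  obtain ⟨w, rfl⟩ := exists_eq_add_mul ht p q
  obtain ⟨w', rfl⟩ := exists_eq_add_mul ht p q'
  have h0 := sq_add_sq_pos_of_add_mul_ne hqp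
  have h0' := sq_add_sq_pos_of_add_mul_ne hqp'
  have h1 := normSq_eq_of_norm_sub_eq (c := -(R : ℂ)) (p := p) (w := w) ht
    (by rw [neg_mul, ← sub_eq_add_neg, hq]; simp [abs_of_pos hR])
  have h2 := normSq_eq_of_norm_sub_eq (c := -(Complex.I * r₁)) (p := p) (w := w) ht
    (by rw [neg_mul, ← sub_eq_add_neg, hq₁]; simp)
  have h3 := normSq_eq_of_norm_sub_eq (c := -(R : ℂ)) (p := p) (w := w') ht
    (by rw [neg_mul, ← sub_eq_add_neg, hq']; simp [abs_of_pos hR])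
  have h4 := normSq_eq_of_norm_sub_eq (c := Complex.I * r₂) ht (by rw [hq₂]; simp)
  simp at h1 h2 h3 h4
  rw [orientation_add_mul ht]
  have hr : r ≠ 0 := by rintro rfl; simp at hr₁
  have hr2 : 0 < r ^ 2 := by positivity
  have hy : 0 < -(r * w.im) := by
    have e : (w.re ^ 2 + w.im ^ 2) * r ^ 2 = 2 * (r * r₁) * -(r * w.im) := by
      linear_combination r ^ 2 * h2
    exact pos_of_mul_pos_right (e ▸ mul_pos h0 hr2) (by linarith)
  have hy' : 0 < r * w'.im := by
    have e : (w'.re ^ 2 + w'.im ^ 2) * r ^ 2 = 2 * (r * r₂) * (r * w'.im) := by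
      linear_combination r ^ 2 * h4
    exact pos_of_mul_pos_right (e ▸ mul_pos h0' hr2) (by linarith)
  -- Here `R * w.re = r₁ * w.im` and `R * w'.re = -r₂ * w'.im`; the factor `r ^ 2` leaves only
  -- quantities of known sign.
  have e : R * r ^ 2 * (r * (w.im * w'.re - w.re * w'.im)) =
      (r * r₁ + r * r₂) * (-(r * w.im) * (r * w'.im)) := by
    linear_combination -r ^ 3 * ((w.im / 2) * (h4 - h3) - (w'.im / 2) * (h2 - h1))
  exact pos_of_mul_pos_right (e ▸ mul_pos (add_pos hr₁ hr₂) (mul_pos hy hy')) (by positivity)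

/-! ### A frame yields an orthogonal ring pattern -/

namespace RingPattern

variable {P : RingPattern} {t : ℤ → ℤ → ℂ}

theorem HasFrame.orthogonal_inner_outer_horizontal (h : P.HasFrame t) (hR : ∀ m n, 0 < P.outer m n)
    (m n : ℤ) : OrthogonalCircles (P.center m n) |P.inner m n|
      (P.center (m + 1) n) (P.outer (m + 1) n) := by
  rw [← abs_of_pos (hR (m + 1) n), ← abs_neg (P.outer (m + 1) n)]
  refine (orthogonalCircles_of_radius_vectors (h.norm_eq m n) ?_ (h.center₀₀ m n)).symm
  rw [h.center₁₀]; push_cast; ring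

theorem HasFrame.orthogonal_inner_outer_vertical (h : P.HasFrame t) (hR : ∀ m n, 0 < P.outer m n)
    (m n : ℤ) : OrthogonalCircles (P.center m n) |P.inner m n|
      (P.center m (n + 1)) (P.outer m (n + 1)) := by
  rw [← abs_of_pos (hR m (n + 1))]
  exact (orthogonalCircles_of_radius_vectors (h.norm_eq m n) (h.center₀₁ m n)
    (h.center₀₀ m n)).symm

theorem HasFrame.orthogonal_outer_inner_horizontal (h : P.HasFrame t) (hR : ∀ m n, 0 < P.outer m n)
    (m n : ℤ) : OrthogonalCircles (P.center m n) (P.outer m n)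
      (P.center (m + 1) n) |P.inner (m + 1) n| := by
  -- In the square below the edge the two ends exchange roles: there the outer circle at `(m, n)`
  -- meets the inner one at `(m + 1, n)`.
  obtain ⟨k, rfl⟩ : ∃ k, n = k + 1 := ⟨n - 1, by ring⟩
  rw [← abs_of_pos (hR m (k + 1)), ← abs_neg (P.inner (m + 1) (k + 1))]
  refine orthogonalCircles_of_radius_vectors (h.norm_eq m k) (h.center₀₁ m k) ?_
  rw [h.center₁₁]; push_cast; ring

theorem HasFrame.orthogonal_outer_inner_vertical (h : P.HasFrame t) (hR : ∀ m n, 0 < P.outer m n)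
    (m n : ℤ) : OrthogonalCircles (P.center m n) (P.outer m n)
      (P.center m (n + 1)) |P.inner m (n + 1)| := by
  obtain ⟨k, rfl⟩ : ∃ k, m = k + 1 := ⟨m - 1, by ring⟩
  rw [← abs_of_pos (hR (k + 1) n), ← abs_neg (P.inner (k + 1) (n + 1)),
    ← abs_neg (P.outer (k + 1) n)]
  refine orthogonalCircles_of_radius_vectors (p := P.touch k n) (h.norm_eq k n) ?_ ?_
  · rw [h.center₁₀]; push_cast; ring
  · rw [h.center₁₁]; push_cast; ring

theorem HasFrame.isOrthogonal (h : P.HasFrame t) (hR : ∀ m n, 0 < P.outer m n) :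
    P.IsOrthogonal where
  outer_pos := hR
  horizontal m n := ⟨h.orthogonal_outer_inner_horizontal hR m n,
    h.orthogonal_inner_outer_horizontal hR m n⟩
  vertical m n := ⟨h.orthogonal_outer_inner_vertical hR m n,
    h.orthogonal_inner_outer_vertical hR m n⟩
  contact := h.hasContact
  orient_inner := by
    rintro m n q ⟨⟨hq, hq₁⟩, hq₂⟩ q' ⟨⟨hq', hq₁'⟩, hq₂'⟩
    simp only [innerCircle, outerCircle, mem_sphere_iff_norm] at *
    rw [h.center₀₀] at hq hq'
    rw [h.center₁₀] at hq₁ hq₂'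
    rw [h.center₀₁] at hq₂ hq₁'
    have ht := h.norm_eq m n
    -- The touching point lies on both outer circles, so the set differences exclude it.
    refine orientation_inner_pos ht (hR _ _) (hR _ _) hq hq₁ ?_ hq' hq₁' ?_
    · rintro rfl
      refine hq₂ ?_
      rw [sub_add_cancel_left, norm_neg, norm_mul, ht, mul_one, Complex.norm_real,
        Real.norm_of_nonneg (hR _ _).le]
    · rintro rfl
      refine hq₂' ?_
      rw [sub_sub_cancel, norm_mul, ht, mul_one, Complex.norm_real,
        Real.norm_of_nonneg (hR _ _).le]
  orient_outer := by
    rintro m n hr₁ hr₂ q ⟨⟨hq, hq₁⟩, hq₂⟩ q' ⟨⟨hq', hq₁'⟩, hq₂'⟩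
    obtain ⟨k, rfl⟩ : ∃ k, m = k + 1 := ⟨m - 1, by ring⟩
    simp only [innerCircle, outerCircle, mem_sphere_iff_norm, add_sub_cancel_right] at *
    rw [h.center₁₀] at hq hq'
    rw [h.center₁₁] at hq₁ hq₂'
    rw [h.center₀₀] at hq₂ hq₁'
    have ht := h.norm_eq k n
    refine orientation_outer_pos ht (hR _ _) hr₁ hr₂ hq hq₁ ?_ hq' hq₁' ?_
    · rintro rfl
      refine hq₂ ?_
      rw [sub_add_cancel_left, norm_neg, norm_mul, norm_mul, ht, mul_one, Complex.norm_real,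
        Complex.norm_I, one_mul, Real.norm_eq_abs]
    · rintro rfl
      refine hq₂' ?_
      rw [sub_sub_cancel, norm_mul, norm_mul, ht, mul_one, Complex.norm_real,
        Complex.norm_I, one_mul, Real.norm_eq_abs]

/-! ### Angles at the centres -/

/-- The radius vectors are `-i r t (m, n)` above the edge and `-R t (m, n - 1)` below it, where `(m,
n)` is an upper left corner. -/
theorem HasFrame.angleRight_eq {a : ℝ} (h : P.HasFrame t)
    (hP : TangentCompat a P.inner P.outer) (m n : ℤ) : P.angleRight m n =
      Complex.arg ((P.inner m n / P.outer m n : ℝ) * (Complex.I * unitStep (a * (n : ℝ)))) := by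
  obtain ⟨k, rfl⟩ : ∃ k, n = k + 1 := ⟨n - 1, by ring⟩
  have hR : (P.outer m (k + 1) : ℂ) ≠ 0 := by exact_mod_cast (hP.outer_pos m (k + 1)).ne'
  have ht := h.frame_ne_zero m k
  rw [angleRight, add_sub_cancel_right]
  congr 1
  conv_lhs => arg 2; rw [h.center₀₁ m k, sub_add_cancel_left]
  rw [h.center₀₀ m (k + 1), sub_add_cancel_left, h.frame_add_one_right hP]
  push_cast
  field_simp

theorem HasFrame.angleUp_eq {a : ℝ} (h : P.HasFrame t)
    (hP : TangentCompat a P.inner P.outer) (m n : ℤ) (hr : P.inner m n ≠ 0) : P.angleUp m n =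
      Complex.arg ((P.outer m n / P.inner m n : ℝ) * (Complex.I * unitStep (a * (m : ℝ)))) := by
  obtain ⟨k, rfl⟩ : ∃ k, m = k + 1 := ⟨m - 1, by ring⟩
  have hr' : (P.inner (k + 1) n : ℂ) ≠ 0 := by exact_mod_cast hr
  have ht := h.frame_ne_zero (k + 1) n
  rw [angleUp, add_sub_cancel_right]
  congr 1
  conv_lhs => arg 1; rw [h.center₁₀ k n, sub_sub_cancel, h.frame_add_one_left hP]
  rw [h.center₀₀ (k + 1) n, sub_add_cancel_left]
  push_cast
  field_simp
  rw [Complex.I_sq]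
  ring

theorem angle_eq_of_inner_pos {a : ℝ} (hP : P.IsOrthogonal)
    (hc : TangentCompat a P.inner P.outer) {m n : ℤ} (hr : 0 < P.inner m n) :
    P.angleRight m n = Real.pi - 2 * Real.arctan (Real.exp (-(a * (n : ℝ)))) ∧
    P.angleUp m n = Real.pi - 2 * Real.arctan (Real.exp (-(a * (m : ℝ)))) := by
  obtain ⟨t, ht⟩ := HasContact.exists_frame hP.contact
  have hR := hP.outer_pos m n
  rw [ht.angleRight_eq hc, ht.angleUp_eq hc _ _ hr.ne', Complex.arg_real_mul _ (div_pos hr hR),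
    Complex.arg_real_mul _ (div_pos hR hr)]
  exact ⟨arg_I_mul_unitStep _, arg_I_mul_unitStep _⟩

theorem angle_eq_of_inner_neg {a : ℝ} (hP : P.IsOrthogonal)
    (hc : TangentCompat a P.inner P.outer) {m n : ℤ} (hr : P.inner m n < 0) :
    P.angleRight m n = -(2 * Real.arctan (Real.exp (-(a * (n : ℝ))))) ∧
    P.angleUp m n = -(2 * Real.arctan (Real.exp (-(a * (m : ℝ))))) := by
  obtain ⟨t, ht⟩ := HasContact.exists_frame hP.contact
  have hR := hP.outer_pos m n
  have neg_mul_neg' : ∀ (x : ℝ) (z : ℂ), (x : ℂ) * z = ((-x : ℝ) : ℂ) * -z := fun x z => by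
    push_cast; ring
  rw [ht.angleRight_eq hc, ht.angleUp_eq hc _ _ hr.ne, neg_mul_neg' (P.inner m n / P.outer m n),
    neg_mul_neg' (P.outer m n / P.inner m n),
    Complex.arg_real_mul _ (neg_pos.2 (div_neg_of_neg_of_pos hr hR)),
    Complex.arg_real_mul _ (neg_pos.2 (div_neg_of_pos_of_neg hR hr))]
  exact ⟨arg_neg_I_mul_unitStep _, arg_neg_I_mul_unitStep _⟩

theorem HasRhoRadii.inner_eq {ℓ : ℝ} {ρ : ℤ → ℤ → ℝ} (h : P.HasRhoRadii ℓ ρ) :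
    P.inner = fun m n => ℓ * Real.sinh (ρ m n) := by
  ext m n; exact (h m n).2

theorem HasRhoRadii.outer_eq {ℓ : ℝ} {ρ : ℤ → ℤ → ℝ} (h : P.HasRhoRadii ℓ ρ) :
    P.outer = fun m n => ℓ * Real.cosh (ρ m n) := by
  ext m n; exact (h m n).1

theorem HasRhoRadii.tangentCompat {a δ ℓ : ℝ} (hℓ : 0 < ℓ)
    (h : P.HasRhoRadii ℓ (fun m n => a * (m : ℝ) * (n : ℝ) + δ)) :
    TangentCompat a P.inner P.outer := by
  rw [h.inner_eq, h.outer_eq]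
  exact tangentCompat_cosh_sinh a δ hℓ

theorem exists_isOrthogonal_hasRhoRadii (a δ : ℝ) {ℓ : ℝ} (hℓ : 0 < ℓ) :
    ∃ P : RingPattern, P.IsOrthogonal ∧
      P.HasRhoRadii ℓ (fun m n => a * (m : ℝ) * (n : ℝ) + δ) := by
  have hc := tangentCompat_cosh_sinh a δ hℓ
  obtain ⟨P, t, hr, hR, ht⟩ := exists_frame_of_compat hc
  refine ⟨P, ht.isOrthogonal ?_, fun m n => ⟨by rw [hR], by rw [hr]⟩⟩
  rw [hR]
  exact hc.outer_pos

end RingPattern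

/-! ### Circle patterns, their mirror images and reflections -/

namespace CirclePattern

theorem IsOrthogonalWithLogRadii.radius_eq {C : CirclePattern} {ρ : ℤ → ℤ → ℝ}
    (h : C.IsOrthogonalWithLogRadii ρ) : C.radius = fun m n => Real.exp (ρ m n) := by
  ext m n; exact h.2 m n

theorem exists_isOrthogonalWithLogRadii (a : ℝ) :
    ∃ C : CirclePattern, C.IsOrthogonalWithLogRadii (fun m n => a * (m : ℝ) * (n : ℝ)) := by
  have hc := tangentCompat_exp a
  obtain ⟨P, t, hr, hR, ht⟩ := RingPattern.exists_frame_of_compat hc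
  have hpos : ∀ m n, 0 < P.outer m n := hR ▸ hc.outer_pos
  have hrR : P.inner = P.outer := hr.trans hR.symm
  refine ⟨⟨P.center, P.outer, P.touch⟩, ⟨hpos, fun m n => ?_, fun m n => ?_, fun m n => ?_⟩,
    fun m n => by rw [hR]⟩
  · have h := ht.orthogonal_inner_outer_horizontal hpos m n
    rwa [hrR, abs_of_pos (hpos _ _)] at h
  · have h := ht.orthogonal_inner_outer_vertical hpos m n
    rwa [hrR, abs_of_pos (hpos _ _)] at h
  · have h := ht.hasContact m n
    rwa [hrR] at h

theorem congruent_of_logRadii {a : ℝ} {C D : CirclePattern}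
    (hC : C.IsOrthogonalWithLogRadii (fun m n => a * (m : ℝ) * (n : ℝ)))
    (hD : D.IsOrthogonalWithLogRadii (fun m n => a * (m : ℝ) * (n : ℝ))) : C.Congruent D := by
  have hc : TangentCompat a C.toRings.inner C.toRings.outer := by
    simp only [toRings, hC.radius_eq]
    exact tangentCompat_exp a
  have hr : D.radius = C.radius := hD.radius_eq.trans hC.radius_eq.symm
  obtain ⟨u, b, hu, h⟩ := RingPattern.congruent_of_radii (P := C.toRings) (Q := D.toRings) a
    hC.1.contact hc hD.1.contact hr hr
  exact ⟨u, b, hu, fun m n => ⟨(h m n).1, (h m n).2.1, (h m n).2.2.1⟩⟩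

/-- Conjugating the frame changes the sign of `i` in `i r t` only, which the negative inner radii
compensate. -/
theorem IsOrthogonal.hasContact_mirrorRings {C : CirclePattern} (h : C.IsOrthogonal) :
    C.mirrorRings.HasContact := by
  obtain ⟨t, ht⟩ := RingPattern.HasContact.exists_frame (P := C.toRings) h.contact
  refine RingPattern.HasFrame.hasContact (t := fun m n => (starRingEnd ℂ) (t m n))
    ⟨fun m n => ?_, fun m n => ?_, fun m n => ?_, fun m n => ?_, fun m n => ?_⟩
  · rw [RCLike.norm_conj, ht.norm_eq]
  · have e := congrArg (starRingEnd ℂ) (ht.center₀₀ m n)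
    simp [toRings, mirrorRings] at e ⊢
    exact e
  · have e := congrArg (starRingEnd ℂ) (ht.center₁₀ m n)
    simp [toRings, mirrorRings] at e ⊢
    exact e
  · have e := congrArg (starRingEnd ℂ) (ht.center₁₁ m n)
    simp [toRings, mirrorRings] at e ⊢
    exact e
  · have e := congrArg (starRingEnd ℂ) (ht.center₀₁ m n)
    simp [toRings, mirrorRings] at e ⊢
    exact e

theorem IsOrthogonal.hasContact_reflectedRings {C : CirclePattern} (h : C.IsOrthogonal) :
    C.reflectedRings.HasContact := by
  obtain ⟨t, ht⟩ := RingPattern.HasContact.exists_frame (P := C.toRings) h.contact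
  -- The reflection swaps left and right corners, hence the corners carrying inner and outer
  -- circles; the quarter turn `-i` of the tangent accounts for this together with the change of
  -- sign.
  refine RingPattern.HasFrame.hasContact (t := fun m n => -(Complex.I * t (-m - 1) n))
    ⟨fun m n => ?_, fun m n => ?_, fun m n => ?_, fun m n => ?_, fun m n => ?_⟩
  · rw [norm_neg, norm_mul, ht.norm_eq, Complex.norm_I, one_mul]
  · have e := ht.center₁₀ (-m - 1) n
    simp only [toRings, reflectedRings, sub_add_cancel] at e ⊢
    rw [e]
    push_cast
    linear_combination -C.radius (-m) n * t (-m - 1) n * Complex.I_sq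
  · have e := ht.center₀₀ (-m - 1) n
    simp only [toRings, reflectedRings, neg_add, ← sub_eq_add_neg] at e ⊢
    rw [e]
    ring
  · have e := ht.center₀₁ (-m - 1) n
    simp only [toRings, reflectedRings, neg_add, ← sub_eq_add_neg] at e ⊢
    rw [e]
    push_cast
    linear_combination C.radius (-m - 1) (n + 1) * t (-m - 1) n * Complex.I_sq
  · have e := ht.center₁₁ (-m - 1) n
    simp only [toRings, reflectedRings, sub_add_cancel] at e ⊢
    rw [e]
    ring

end CirclePattern

/-! ### The main theorem -/

theorem proposition2 (a : ℝ) (ha : 0 < a) :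
    -- the `ρ`-radii `a m n`, and all their shifts by `δ`, belong to an orthogonal ring pattern
    -- of any given ring area `π ℓ ^ 2`, which is unique up to congruence
    (∀ δ ℓ : ℝ, 0 < ℓ →
      (∃ P : RingPattern, P.IsOrthogonal ∧
        P.HasRhoRadii ℓ (fun m n => a * (m : ℝ) * (n : ℝ) + δ)) ∧
      ∀ P Q : RingPattern,
        P.IsOrthogonal → P.HasRhoRadii ℓ (fun m n => a * (m : ℝ) * (n : ℝ) + δ) →
        Q.IsOrthogonal → Q.HasRhoRadii ℓ (fun m n => a * (m : ℝ) * (n : ℝ) + δ) →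
        P.Congruent Q) ∧
    -- the angles of the Erf ring pattern, and their constancy within each quadrant
    (∀ ℓ : ℝ, 0 < ℓ → ∀ P : RingPattern, P.IsOrthogonal →
      P.HasRhoRadii ℓ (fun m n => a * (m : ℝ) * (n : ℝ)) →
      (∀ m n : ℤ, 0 < m * n →
        P.angleRight m n = Real.pi - 2 * Real.arctan (Real.exp (-(a * (n : ℝ)))) ∧
        P.angleUp m n = Real.pi - 2 * Real.arctan (Real.exp (-(a * (m : ℝ))))) ∧
      (∀ m n : ℤ, m * n < 0 →
        P.angleRight m n = -(2 * Real.arctan (Real.exp (-(a * (n : ℝ))))) ∧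
        P.angleUp m n = -(2 * Real.arctan (Real.exp (-(a * (m : ℝ)))))) ∧
      (∀ m m' n : ℤ, 0 < m * m' → n ≠ 0 → P.angleRight m n = P.angleRight m' n) ∧
      (∀ m n n' : ℤ, 0 < n * n' → m ≠ 0 → P.angleUp m n = P.angleUp m n')) ∧
    -- the `√i`-Erf circle pattern exists and is unique up to congruence, and so does its dual
    (∀ ε : ℝ, ε = 1 ∨ ε = -1 →
      (∃ C : CirclePattern,
        C.IsOrthogonalWithLogRadii (fun m n => ε * (a * (m : ℝ) * (n : ℝ)))) ∧
      ∀ C D : CirclePattern,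
        C.IsOrthogonalWithLogRadii (fun m n => ε * (a * (m : ℝ) * (n : ℝ))) →
        D.IsOrthogonalWithLogRadii (fun m n => ε * (a * (m : ℝ) * (n : ℝ))) →
        C.Congruent D) ∧
    -- the limits of the one parameter family, scaled by `2 exp (-|δ|)`
    (∀ F : ℝ → RingPattern,
      (∀ δ, (F δ).IsOrthogonal ∧ (F δ).HasRhoRadii (2 * Real.exp (-|δ|))
        (fun m n => a * (m : ℝ) * (n : ℝ) + δ)) →
      (∀ C : CirclePattern,
        C.IsOrthogonalWithLogRadii (fun m n => a * (m : ℝ) * (n : ℝ)) →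
        RingPattern.ConvergesTo F atTop C.toRings ∧
        RingPattern.ConvergesTo F atBot C.reflectedRings) ∧
      (∀ D : CirclePattern,
        D.IsOrthogonalWithLogRadii (fun m n => -(a * (m : ℝ) * (n : ℝ))) →
        RingPattern.ConvergesTo F atBot D.mirrorRings)) := by
  have hℓδ : ∀ δ : ℝ, 0 < 2 * Real.exp (-|δ|) := fun δ => by positivity
  refine ⟨fun δ ℓ hℓ => ⟨RingPattern.exists_isOrthogonal_hasRhoRadii a δ hℓ,
    fun P Q hP hPr hQ hQr => RingPattern.congruent_of_radii a hP.contact (hPr.tangentCompat hℓ)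
      hQ.contact (hQr.inner_eq.trans hPr.inner_eq.symm) (hQr.outer_eq.trans hPr.outer_eq.symm)⟩,
    fun ℓ hℓ P hP hPr => ?_, fun ε _ => ?_, fun F hF => ?_⟩
  · have hc : TangentCompat a P.inner P.outer :=
      RingPattern.HasRhoRadii.tangentCompat (δ := 0) hℓ (by simpa using hPr)
    have hpos : ∀ m n : ℤ, 0 < m * n → 0 < P.inner m n := fun m n h => by
      rw [(hPr m n).2]
      beta_reduce
      rw [mul_assoc a]
      exact mul_pos hℓ (Real.sinh_pos_iff.2 (mul_pos ha (by exact_mod_cast h)))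
    have hneg : ∀ m n : ℤ, m * n < 0 → P.inner m n < 0 := fun m n h => by
      rw [(hPr m n).2]
      beta_reduce
      rw [mul_assoc a]
      exact mul_neg_of_pos_of_neg hℓ
        (Real.sinh_neg_iff.2 (mul_neg_of_pos_of_neg ha (by exact_mod_cast h)))
    have h1 := fun m n h => P.angle_eq_of_inner_pos hP hc (hpos m n h)
    have h2 := fun m n h => P.angle_eq_of_inner_neg hP hc (hneg m n h)
    refine ⟨h1, h2, fun m m' n hm hn => ?_, fun m n n' hn hm => ?_⟩
    · rcases lt_trichotomy (m * n) 0 with h | h | h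
      -- `(m n)(m' n) = (m m') n² > 0`, so both vertices lie in quadrants with the same sign of the
      -- inner radius.
      · rw [(h2 m n h).1, (h2 m' n (by nlinarith [sq_pos_of_ne_zero hn])).1]
      · rcases mul_eq_zero.1 h with h | h
        · simp [h] at hm
        · exact absurd h hn
      · rw [(h1 m n h).1, (h1 m' n (by nlinarith [sq_pos_of_ne_zero hn])).1]
    · rcases lt_trichotomy (m * n) 0 with h | h | h
      · rw [(h2 m n h).2, (h2 m n' (by nlinarith [sq_pos_of_ne_zero hm])).2]
      · rcases mul_eq_zero.1 h with h | h
        · exact absurd h hm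
        · simp [h] at hn
      · rw [(h1 m n h).2, (h1 m n' (by nlinarith [sq_pos_of_ne_zero hm])).2]
  -- Both signs are the same statement with `ε * a` as parameter.
  · simp only [← mul_assoc]
    exact ⟨CirclePattern.exists_isOrthogonalWithLogRadii _,
      fun C D => CirclePattern.congruent_of_logRadii⟩
  · have hFc : ∀ δ, (F δ).HasContact := fun δ => (hF δ).1.contact
    have hFt := fun δ => (hF δ).2.tangentCompat (hℓδ δ)
    refine ⟨fun C hC => ⟨?_, ?_⟩, fun D hD => ?_⟩
    · refine RingPattern.convergesTo_of_radii a hFc hFt hC.1.contact hC.1.radius_pos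
        (fun m n => ?_) fun m n => ?_
      · simp only [fun δ => ((hF δ).2 m n).2, CirclePattern.toRings, hC.2 m n]
        exact (tendsto_cosh_sinh_atTop _).2
      · simp only [fun δ => ((hF δ).2 m n).1, CirclePattern.toRings, hC.2 m n]
        exact (tendsto_cosh_sinh_atTop _).1
    -- Reflecting `m` inverts the radii, so the limit at `-∞` is compared with `C` directly, without
    -- its dual.
    · have e : ∀ m n : ℤ, C.radius (-m) n = Real.exp (-(a * (m : ℝ) * (n : ℝ))) := fun m n => by
        rw [hC.2]; congr 1; push_cast; ring
      refine RingPattern.convergesTo_of_radii a hFc hFt hC.1.hasContact_reflectedRings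
        (fun m n => hC.1.radius_pos _ _) (fun m n => ?_) fun m n => ?_
      · simp only [fun δ => ((hF δ).2 m n).2, CirclePattern.reflectedRings, e]
        exact (tendsto_cosh_sinh_atBot _).2
      · simp only [fun δ => ((hF δ).2 m n).1, CirclePattern.reflectedRings, e]
        exact (tendsto_cosh_sinh_atBot _).1
    · refine RingPattern.convergesTo_of_radii a hFc hFt hD.1.hasContact_mirrorRings
        hD.1.radius_pos (fun m n => ?_) fun m n => ?_
      · simp only [fun δ => ((hF δ).2 m n).2, CirclePattern.mirrorRings, hD.2 m n]
        exact (tendsto_cosh_sinh_atBot _).2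
      · simp only [fun δ => ((hF δ).2 m n).1, CirclePattern.mirrorRings, hD.2 m n]
        exact (tendsto_cosh_sinh_atBot _).1
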